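/- Let $T$ be a rooted tree with vertex set $[n]=\{1,\dots,n\}$ and all edges oriented towards the root. For a sequence $s=(s_1,\dots,s_n)\in[n]^n$, drivers $1,\dots,n$ arrive in this order; driver $i$ starts at the vertex $s_i$ and parks at the first unoccupied vertex on the directed path from $s_i$ to the root, leaving without parking if there is none. The pair $(T,s)$ is a *parking function* if all $n$ drivers park. For a vertex $v$, let $T_v$ be the set of all vertices $u$ (including $v$) from which there is a directed path to $v$. A parking function $(T,s)$ is *prime* if $|T_v|<|\{i : s_i\in T_v\}|$ for every non-root vertex $v$, and a *prime parking distribution* is a prime parking function $(T,s)$ for which $s$ is weakly increasing. **Theorem.** For every $n\ge 1$, the total number $\widetilde P_n$ of prime parking distributions $(T,s)$, where $T$ ranges over all rooted trees with vertex set $[n]$, is $$\widetilde P_n=(n-1)!\,S_{n-1},$$ where $(S_i)_{i\ge 0}$ are the large Schröder numbers, given by $S_0=1$ and $S_{m+1}=S_m+\sum_{i=0}^{m}S_iS_{m-i}$ for $m\ge 0$ (so $1,2,6,22,90,\dots$). -/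

import Mathlib

/-- A rooted tree with vertex set `Fin n` (the labels `1, …, n` shifted to `0, …, n - 1`), with all
edges oriented towards the root. Every non-root vertex `v` has exactly one outgoing edge, namely
`v → parent v`, and following the edges from any vertex leads to the root. The root has no outgoing
edge; the convention `parent root = root` makes the encoding of each tree unique. -/
@[ext]
structure LabeledRootedTree (n : ℕ) where
  root : Fin n
  parent : Fin n → Fin n
  parent_root : parent root = root
  exists_iterate_eq_root : ∀ v, ∃ k : ℕ, parent^[k] v = root

namespace LabeledRootedTree

variable {n : ℕ} (T : LabeledRootedTree n)

/-- The number of edges on the directed path from `v` to the root. -/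
def depth (v : Fin n) : ℕ := Nat.find (T.exists_iterate_eq_root v)

/-- The vertices of the directed path from `v` to the root, in the order in which a driver starting
at `v` passes them: `v, parent v, …, root`. -/
def pathToRoot (v : Fin n) : List (Fin n) :=
  (List.range (T.depth v + 1)).map fun k => T.parent^[k] v

/-- `T.Below u v` means that there is a directed path (possibly of length `0`) from `u` to `v`. -/
def Below (u v : Fin n) : Prop := ∃ k : ℕ, T.parent^[k] u = v

/-- The vertex set of the subtree `T_v`: all vertices from which there is a directed path
to `v`. -/
def below (v : Fin n) : Set (Fin n) := {u | T.Below u v}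

/-- The spot where a driver preferring `v` parks if the spots in `occ` are occupied: the first
unoccupied spot on the path from `v` to the root, or `none` if there is no such spot and the driver
leaves without parking. -/
def spot (occ : Finset (Fin n)) (v : Fin n) : Option (Fin n) :=
  (T.pathToRoot v).find? fun w => decide (w ∉ occ)

/-- The set of occupied spots after a driver preferring `v` has arrived, when the spots in `occ`
were occupied before. -/
def arrive (occ : Finset (Fin n)) (v : Fin n) : Finset (Fin n) :=
  match T.spot occ v with
  | some w => insert w occ
  | none => occ

/-- The set of occupied spots after drivers with the listed preferences have arrived one by one,
starting from the empty tree. -/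
def occupied (l : List (Fin n)) : Finset (Fin n) := l.foldl T.arrive ∅

/-- `s` is a parking function on `T`: for each driver `i`, when she arrives after the
drivers `j < i`, there is a spot where she parks. -/
def IsParkingFunction (s : Fin n → Fin n) : Prop :=
  ∀ i : Fin n, (T.spot (T.occupied ((List.ofFn s).take i)) (s i)).isSome

/-- `s` is a prime parking function on `T`: a parking function such that
`|T_v| < |{i : s i ∈ T_v}|` for every non-root vertex `v`. -/
def IsPrimeParkingFunction (s : Fin n → Fin n) : Prop :=
  T.IsParkingFunction s ∧
    ∀ v : Fin n, v ≠ T.root → (T.below v).ncard < {i : Fin n | s i ∈ T.below v}.ncard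

/-- `s` is a prime parking distribution on `T`: a prime parking function that is weakly
increasing. -/
def IsPrimeParkingDistribution (s : Fin n → Fin n) : Prop :=
  T.IsPrimeParkingFunction s ∧ Monotone s

end LabeledRootedTree

/-! The parking condition is redundant: if a driver leaves, some spot `w` stays empty, so fewer than
`|T_w|` drivers prefer `T_w`, against primality or, at the root, against the total `n`
(`isPrimeParkingFunction_iff`). A weakly increasing `s` is determined by its driver multiplicities.
So the objects to count are trees with a multiplicity at each vertex and more drivers than vertices
in every proper subtree.

Allow `|V| + q - 1` drivers on a vertex set `V`. Cutting an edge into the root splits such a tree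
into two of the same kind, with parameters `a + b = q + 1`, where `b ≥ 2` belongs to the branch.
Weighting each branch by its size gives `card_primeTrees_recursion`, which determines all counts
from the one-vertex trees.

For the exponential generating functions `h_q(x)`, with `h = ∑ h_q t^q` and `∂ = x d/dx`, the
recursion reads `t (∂h - h) = h (∂h - x - t ∂h_1)`. The solution is guessed: `parkingColumn` is
defined by a linear recursion in `q` whose first step gives `∂h_1 = x S(x)`, with `S` the Schröder
series. The defect of the nonlinear equation then satisfies a homogeneous linear equation with zero
initial data and vanishes (`parkingSeries_functional_equation`). Hence `h_1` counts the case `q =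
1`, and its coefficients give the theorem. -/

/-! ### Rooted trees as parent functions: cutting and gluing at the root -/

/-- `p` is the parent function of a tree with vertex set `V` and root `r`; it is extended by the
identity outside `V`. -/
structure IsTreeOn {α : Type*} (V : Finset α) (r : α) (p : α → α) : Prop where
  root_mem : r ∈ V
  map_root : p r = r
  map_mem : ∀ u ∈ V, p u ∈ V
  map_off : ∀ u ∉ V, p u = u
  reach : ∀ u ∈ V, ∃ k : ℕ, p^[k] u = r

/-- `p` arises from the parent functions `pA`, `pB` of trees on the disjoint sets `A`, `B` by
adding an edge from the root `rB` to the root `rA`. -/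
structure IsGluing {α : Type*} (A B : Finset α) (rA rB : α) (pA pB p : α → α) : Prop where
  disj : Disjoint A B
  left : IsTreeOn A rA pA
  right : IsTreeOn B rB pB
  eq_left : ∀ u ∈ A, p u = pA u
  eq_right : ∀ u ∈ B, u ≠ rB → p u = pB u
  map_root : p rB = rA
  map_off : ∀ u, u ∉ A → u ∉ B → p u = u

theorem IsTreeOn.isGluing_ite {α : Type*} [DecidableEq α] {A B : Finset α} {rA rB : α} {pA pB : α → α} (hA : IsTreeOn A rA pA)
    (hB : IsTreeOn B rB pB) (hAB : Disjoint A B) :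
    IsGluing A B rA rB pA pB (fun u => if u = rB then rA else if u ∈ B then pB u else pA u) := by
  refine ⟨hAB, hA, hB, fun u hu => ?_, fun u hu hur => ?_, ?_, fun u hu hu' => ?_⟩
  · have hu' := Finset.disjoint_left.1 hAB hu
    rw [if_neg (fun e : u = rB => hu' (e ▸ hB.root_mem)), if_neg hu']
  · rw [if_neg hur, if_pos hu]
  · rw [if_pos rfl]
  · rw [if_neg (fun e : u = rB => hu' (e ▸ hB.root_mem)), if_neg hu', hA.map_off u hu]

open Classical in
/-- The vertices from which `v` can be reached by iterating `p`. -/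
noncomputable def descendants {α : Type*} [Fintype α] (p : α → α) (v : α) : Finset α :=
  Finset.univ.filter fun u => ∃ k : ℕ, p^[k] u = v

section Trees

variable {α : Type*} [Fintype α]

theorem mem_descendants {p : α → α} {u v : α} : u ∈ descendants p v ↔ ∃ k : ℕ, p^[k] u = v := by
  simp [descendants]

theorem self_mem_descendants (p : α → α) (v : α) : v ∈ descendants p v :=
  mem_descendants.2 ⟨0, rfl⟩

theorem mem_descendants_of_map {p : α → α} {u v : α} (h : p u ∈ descendants p v) :
    u ∈ descendants p v := by
  obtain ⟨k, hk⟩ := mem_descendants.1 h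
  exact mem_descendants.2 ⟨k + 1, hk⟩

theorem map_mem_descendants {p : α → α} {u v : α} (h : u ∈ descendants p v) (huv : u ≠ v) :
    p u ∈ descendants p v := by
  obtain ⟨k, hk⟩ := mem_descendants.1 h
  rcases k with _ | k
  · exact absurd hk huv
  · exact mem_descendants.2 ⟨k, hk⟩

theorem eq_of_mem_descendants_of_fixed {p : α → α} {u v : α} (h : u ∈ descendants p v)
    (hu : p u = u) : u = v := by
  obtain ⟨k, hk⟩ := mem_descendants.1 h
  rwa [Function.iterate_fixed hu] at hk

/-- Induction along the path from a descendant of `v` up to `v`. -/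
theorem descendants_induction {p : α → α} {v : α} {P : α → Prop} (base : P v)
    (step : ∀ u, u ≠ v → p u ∈ descendants p v → P (p u) → P u) {u : α}
    (h : u ∈ descendants p v) : P u := by
  obtain ⟨k, hk⟩ := mem_descendants.1 h
  clear h
  induction k generalizing u with
  | zero => exact (show u = v from hk) ▸ base
  | succ k ih =>
    by_cases huv : u = v
    · exact huv ▸ base
    · exact step u huv (mem_descendants.2 ⟨k, hk⟩) (ih hk)

namespace IsTreeOn

variable {V : Finset α} {r : α} {p : α → α}

theorem descendants_subset (h : IsTreeOn V r p) {v : α} (hv : v ∈ V) : descendants p v ⊆ V := by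
  intro u hu
  by_contra hV
  exact hV (eq_of_mem_descendants_of_fixed hu (h.map_off u hV) ▸ hv)

theorem descendants_root (h : IsTreeOn V r p) : descendants p r = V :=
  (h.descendants_subset h.root_mem).antisymm fun u hu => mem_descendants.2 (h.reach u hu)

theorem root_notMem_descendants (h : IsTreeOn V r p) {v : α} (hv : v ≠ r) :
    r ∉ descendants p v :=
  fun hr => hv (eq_of_mem_descendants_of_fixed hr h.map_root).symm

theorem mem_descendants_comparable {p : α → α} {u v w : α} (hv : u ∈ descendants p v)
    (hw : u ∈ descendants p w) : v ∈ descendants p w ∨ w ∈ descendants p v := by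
  obtain ⟨k, rfl⟩ := mem_descendants.1 hv
  obtain ⟨l, rfl⟩ := mem_descendants.1 hw
  rcases le_total k l with h | h
  · exact Or.inl (mem_descendants.2 ⟨l - k, by rw [← Function.iterate_add_apply]; congr 1; omega⟩)
  · exact Or.inr (mem_descendants.2 ⟨k - l, by rw [← Function.iterate_add_apply]; congr 1; omega⟩)

variable [DecidableEq α]

theorem sum_erase_root_eq_sum_children (h : IsTreeOn V r p) (f : α → ℕ) :
    ∑ u ∈ V.erase r, f u = ∑ v ∈ V with v ≠ r ∧ p v = r, ∑ u ∈ descendants p v, f u := by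
  rw [← Finset.sum_biUnion]
  · congr 1
    ext u
    simp only [Finset.mem_erase, Finset.mem_biUnion, Finset.mem_filter]
    constructor
    · rintro ⟨hur, hu⟩
      have hu' := h.descendants_root ▸ hu
      clear hu
      revert hur
      refine descendants_induction (P := fun u => u ≠ r → ∃ v, (v ∈ V ∧ v ≠ r ∧ p v = r) ∧
        u ∈ descendants p v) (fun h => absurd rfl h) (fun w hwr hw ih _ => ?_) hu'
      by_cases hpw : p w = r
      · refine ⟨w, ⟨?_, hwr, hpw⟩, self_mem_descendants p w⟩
        by_contra hV
        exact hwr ((h.map_off w hV).symm.trans hpw)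
      · obtain ⟨v, hv, hmem⟩ := ih hpw
        exact ⟨v, hv, mem_descendants_of_map hmem⟩
    · rintro ⟨v, ⟨hv, hvr, -⟩, hu⟩
      refine ⟨?_, h.descendants_subset hv hu⟩
      rintro rfl
      exact h.root_notMem_descendants hvr hu
  · intro v hv w hw hvw
    rw [Finset.mem_coe, Finset.mem_filter] at hv hw
    refine Finset.disjoint_left.2 fun u huv huw => ?_
    rcases mem_descendants_comparable huv huw with hc | hc
    · have := map_mem_descendants hc hvw
      rw [hv.2.2] at this
      exact h.root_notMem_descendants hw.2.1 this
    · have := map_mem_descendants hc hvw.symm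
      rw [hw.2.2] at this
      exact h.root_notMem_descendants hv.2.1 this

theorem card_sub_one_eq_sum_children (h : IsTreeOn V r p) :
    V.card - 1 = ∑ v ∈ V with v ≠ r ∧ p v = r, (descendants p v).card := by
  simpa [Finset.card_erase_of_mem h.root_mem] using h.sum_erase_root_eq_sum_children fun _ => 1

end IsTreeOn

variable [DecidableEq α]

namespace IsGluing

variable {A B : Finset α} {rA rB : α} {pA pB p : α → α}

theorem descendants_right (h : IsGluing A B rA rB pA pB p) {v : α} (hv : v ∈ B) :
    descendants p v = descendants pB v := by
  have hvA : v ∉ A := Finset.disjoint_right.1 h.disj hv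
  ext u
  constructor <;> intro hu
  · refine descendants_induction (self_mem_descendants pB v) (fun w hwv hw ih => ?_) hu
    by_cases hwB : w ∈ B
    · by_cases hwr : w = rB
      · rw [hwr, h.map_root] at ih
        exact absurd (eq_of_mem_descendants_of_fixed ih (h.right.map_off rA
          (Finset.disjoint_left.1 h.disj h.left.root_mem)) ▸ h.left.root_mem) hvA
      · exact mem_descendants_of_map (h.eq_right w hwB hwr ▸ ih)
    · by_cases hwA : w ∈ A
      · rw [h.eq_left w hwA] at ih
        have hA := h.left.map_mem w hwA
        exact absurd (eq_of_mem_descendants_of_fixed ih (h.right.map_off _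
          (Finset.disjoint_left.1 h.disj hA)) ▸ hA) hvA
      · rwa [h.map_off w hwA hwB] at ih
  · have hB : ∀ w ∈ descendants pB v, w ∈ B := fun w hw => h.right.descendants_subset hv hw
    refine descendants_induction (self_mem_descendants p v) (fun w hwv hw ih => ?_) hu
    by_cases hwr : w = rB
    · rwa [hwr, h.right.map_root, ← hwr] at ih
    · have hwB := hB w (mem_descendants_of_map hw)
      exact mem_descendants_of_map ((h.eq_right w hwB hwr).symm ▸ ih)

theorem descendants_left (h : IsGluing A B rA rB pA pB p) {v : α} (hv : v ∈ A) (hvr : v ≠ rA) :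
    descendants p v = descendants pA v := by
  have hvB : v ∉ B := Finset.disjoint_left.1 h.disj hv
  ext u
  constructor <;> intro hu
  · refine descendants_induction (self_mem_descendants pA v) (fun w hwv hw ih => ?_) hu
    by_cases hwA : w ∈ A
    · exact mem_descendants_of_map (h.eq_left w hwA ▸ ih)
    · by_cases hwB : w ∈ B
      · by_cases hwr : w = rB
        · rw [hwr, h.map_root] at ih
          exact absurd (eq_of_mem_descendants_of_fixed ih h.left.map_root).symm hvr
        · rw [h.eq_right w hwB hwr] at ih
          have hB := h.right.map_mem w hwB
          exact absurd (eq_of_mem_descendants_of_fixed ih (h.left.map_off _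
            (Finset.disjoint_right.1 h.disj hB)) ▸ hB) hvB
      · rwa [h.map_off w hwA hwB] at ih
  · refine descendants_induction (self_mem_descendants p v) (fun w hwv hw ih => ?_) hu
    have hwA := h.left.descendants_subset hv (mem_descendants_of_map hw)
    exact mem_descendants_of_map ((h.eq_left w hwA).symm ▸ ih)

theorem isTreeOn (h : IsGluing A B rA rB pA pB p) : IsTreeOn (A ∪ B) rA p := by
  have hA : ∀ u ∈ A, u ∈ descendants p rA := by
    intro u hu
    have hu' := h.left.descendants_root ▸ hu
    refine descendants_induction (self_mem_descendants p rA) (fun w hwv hw ih => ?_) hu'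
    have hwA := h.left.descendants_subset h.left.root_mem (mem_descendants_of_map hw)
    exact mem_descendants_of_map ((h.eq_left w hwA).symm ▸ ih)
  have hB : ∀ u ∈ B, u ∈ descendants p rA := by
    intro u hu
    have hu' := h.right.descendants_root ▸ hu
    rw [← h.descendants_right h.right.root_mem] at hu'
    refine descendants_induction (P := fun u => u ∈ descendants p rA) ?_
      (fun w hwv hw ih => mem_descendants_of_map ih) hu'
    exact mem_descendants_of_map (h.map_root ▸ self_mem_descendants p rA)
  refine ⟨Finset.mem_union_left _ h.left.root_mem, ?_, fun u hu => ?_, fun u hu => ?_,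
    fun u hu => ?_⟩
  · rw [h.eq_left _ h.left.root_mem, h.left.map_root]
  · rcases Finset.mem_union.1 hu with hu | hu
    · rw [h.eq_left u hu]; exact Finset.mem_union_left _ (h.left.map_mem u hu)
    · by_cases hur : u = rB
      · rw [hur, h.map_root]; exact Finset.mem_union_left _ h.left.root_mem
      · rw [h.eq_right u hu hur]; exact Finset.mem_union_right _ (h.right.map_mem u hu)
  · rw [Finset.mem_union, not_or] at hu
    exact h.map_off u hu.1 hu.2
  · exact mem_descendants.1 ((Finset.mem_union.1 hu).elim (hA u) (hB u))

end IsGluing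

theorem IsTreeOn.isGluing {V : Finset α} {r v : α} {p : α → α} (h : IsTreeOn V r p)
    (hvr : v ≠ r) (hpv : p v = r) :
    IsGluing (V \ descendants p v) (descendants p v) r v
      (fun u => if u ∈ descendants p v then u else p u)
      (fun u => if u ∈ descendants p v ∧ u ≠ v then p u else u) p := by
  have hr := h.root_notMem_descendants hvr
  refine ⟨Finset.sdiff_disjoint, ⟨?_, ?_, fun u hu => ?_, fun u hu => ?_, fun u hu => ?_⟩,
    ⟨self_mem_descendants p v, ?_, fun u hu => ?_, fun u hu => ?_, fun u hu => ?_⟩,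
    fun u hu => ?_, fun u hu huv => ?_, hpv, fun u hu hu' => ?_⟩
  · exact Finset.mem_sdiff.2 ⟨h.root_mem, hr⟩
  · simp [hr, h.map_root]
  · rw [Finset.mem_sdiff] at hu ⊢
    rw [if_neg hu.2]
    exact ⟨h.map_mem u hu.1, fun hm => hu.2 (mem_descendants_of_map hm)⟩
  · split_ifs with hd
    · rfl
    · exact h.map_off u fun hV => hu (Finset.mem_sdiff.2 ⟨hV, hd⟩)
  · rw [Finset.mem_sdiff] at hu
    rw [← mem_descendants]
    have hu' := h.descendants_root ▸ hu.1
    have hud := hu.2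
    clear hu
    revert hud
    refine descendants_induction (P := fun u => u ∉ descendants p v →
      u ∈ descendants (fun u => if u ∈ descendants p v then u else p u) r)
      (fun _ => self_mem_descendants _ r) (fun w hwr hw ih hwd => ?_) hu'
    refine mem_descendants_of_map ?_
    rw [if_neg hwd]
    exact ih fun hm => hwd (mem_descendants_of_map hm)
  · simp
  · split_ifs with hd
    · exact map_mem_descendants hu hd.2
    · exact hu
  · rw [if_neg fun hd => hu hd.1]
  · rw [← mem_descendants]
    refine descendants_induction (self_mem_descendants _ v) (fun w hwr hw ih => ?_) hu
    refine mem_descendants_of_map ?_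
    rwa [if_pos ⟨mem_descendants_of_map hw, hwr⟩]
  · rw [if_neg (Finset.mem_sdiff.1 hu).2]
  · rw [if_pos ⟨hu, huv⟩]
  · exact h.map_off u fun hV => hu (Finset.mem_sdiff.2 ⟨hV, hu'⟩)

/-! ### Prime trees and their recursion -/

/-- A tree on `V` with `c v` drivers preferring the vertex `v`, such that every edge is crossed. -/
structure IsPrimeOn (V : Finset α) (r : α) (p : α → α) (c : α → ℕ) : Prop where
  tree : IsTreeOn V r p
  support : ∀ u ∉ V, c u = 0
  lt_sum : ∀ v ∈ V, v ≠ r → (descendants p v).card < ∑ u ∈ descendants p v, c u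

/-- Each branch at the root has at least as many drivers as vertices, so only the root itself can be
missing a driver. Thus `q ≥ 0` covers every prime tree, and `a = q + 1 - b` in
`card_markedPrimeTrees` is not truncated. -/
theorem IsPrimeOn.card_le_sum_add_one {V : Finset α} {r : α} {p : α → α} {c : α → ℕ}
    (h : IsPrimeOn V r p c) : V.card ≤ ∑ u ∈ V, c u + 1 := by
  rw [← Nat.sub_le_iff_le_add, h.tree.card_sub_one_eq_sum_children]
  calc _ ≤ ∑ v ∈ V with v ≠ r ∧ p v = r, ∑ u ∈ descendants p v, c u :=
        Finset.sum_le_sum fun v hv => (h.lt_sum v (Finset.mem_filter.1 hv).1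
          (Finset.mem_filter.1 hv).2.1).le
    _ = ∑ u ∈ V.erase r, c u := (h.tree.sum_erase_root_eq_sum_children c).symm
    _ ≤ _ := Finset.sum_le_sum_of_subset (Finset.erase_subset _ _)

open Classical in
/-- The triples (root, parent function, driver multiplicities) on `V` in which every edge is
crossed and in which the number of drivers exceeds the number of vertices by `q - 1`. -/
noncomputable def primeTrees (V : Finset α) (q : ℕ) : Finset (α × (α → α) × (α → ℕ)) :=
  (Finset.univ ×ˢ Finset.univ ×ˢ Finset.piAntidiag V (V.card + q - 1)).filter fun x =>
    IsPrimeOn V x.1 x.2.1 x.2.2 ∧ ∑ u ∈ V, x.2.2 u + 1 = V.card + q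

theorem mem_primeTrees {V : Finset α} {q : ℕ} {x : α × (α → α) × (α → ℕ)} :
    x ∈ primeTrees V q ↔
      IsPrimeOn V x.1 x.2.1 x.2.2 ∧ ∑ u ∈ V, x.2.2 u + 1 = V.card + q := by
  classical
  rw [primeTrees, Finset.mem_filter, and_iff_right_iff_imp]
  rintro ⟨h, hs⟩
  change V.sum x.2.2 + 1 = V.card + q at hs
  simp only [Finset.mem_product, Finset.mem_univ, Finset.mem_piAntidiag, true_and]
  refine ⟨by omega, fun i hi => ?_⟩
  by_contra hV
  exact hi (h.support i hV)

/-- Prime trees on `V` with a marked child `v` of the root below which lies the set `B`. -/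
noncomputable def markedPrimeTrees (V : Finset α) (q : ℕ) (B : Finset α) :
    Finset ((α × (α → α) × (α → ℕ)) × α) :=
  (primeTrees V q ×ˢ V).filter fun y =>
    (y.2 ≠ y.1.1 ∧ y.1.2.1 y.2 = y.1.1) ∧ descendants y.1.2.1 y.2 = B

theorem mem_markedPrimeTrees {V : Finset α} {q : ℕ} {B : Finset α}
    {y : (α × (α → α) × (α → ℕ)) × α} :
    y ∈ markedPrimeTrees V q B ↔ (y.1 ∈ primeTrees V q ∧ y.2 ∈ V) ∧
      (y.2 ≠ y.1.1 ∧ y.1.2.1 y.2 = y.1.1) ∧ descendants y.1.2.1 y.2 = B := by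
  rw [markedPrimeTrees, Finset.mem_filter, Finset.mem_product]

/-- The branches at the root partition the other `|V| - 1` vertices, so weighting each marked branch
by its size counts every tree `|V| - 1` times. -/
theorem sum_card_mul_card_markedPrimeTrees (V : Finset α) (q : ℕ) :
    (V.card - 1) * (primeTrees V q).card =
      ∑ B ∈ V.powerset, B.card * (markedPrimeTrees V q B).card := by
  set Z := (primeTrees V q ×ˢ V).filter fun y => y.2 ≠ y.1.1 ∧ y.1.2.1 y.2 = y.1.1 with hZ
  have h1 : (V.card - 1) * (primeTrees V q).card =
      ∑ y ∈ Z, (descendants y.1.2.1 y.2).card := by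
    rw [hZ, Finset.sum_filter, Finset.sum_product, mul_comm, ← smul_eq_mul, ← Finset.sum_const]
    refine Finset.sum_congr rfl fun x hx => ?_
    rw [(mem_primeTrees.1 hx).1.tree.card_sub_one_eq_sum_children, Finset.sum_filter]
  rw [h1, ← Finset.sum_fiberwise_of_maps_to (s := Z) (t := V.powerset)
    (g := fun y => descendants y.1.2.1 y.2)]
  · refine Finset.sum_congr rfl fun B _ => ?_
    rw [hZ, Finset.filter_filter, ← markedPrimeTrees, mul_comm, ← smul_eq_mul, ← Finset.sum_const]
    refine Finset.sum_congr rfl fun y hy => ?_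
    rw [(mem_markedPrimeTrees.1 hy).2.2]
  · intro y hy
    rw [hZ, Finset.mem_filter, Finset.mem_product] at hy
    exact Finset.mem_powerset.2
      ((mem_primeTrees.1 hy.1.1).1.tree.descendants_subset hy.1.2)

/-- The only proper ancestor of `v` is the root, which carries no condition; so the cut leaves every
other subtree, with its drivers, unchanged. -/
theorem IsPrimeOn.cut {V : Finset α} {r v : α} {p : α → α} {c : α → ℕ} (h : IsPrimeOn V r p c)
    (hv : v ∈ V) (hvr : v ≠ r) (hpv : p v = r) :
    IsPrimeOn (V \ descendants p v) r (fun u => if u ∈ descendants p v then u else p u)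
      (fun u => if u ∈ descendants p v then 0 else c u) ∧
    IsPrimeOn (descendants p v) v (fun u => if u ∈ descendants p v ∧ u ≠ v then p u else u)
      (fun u => if u ∈ descendants p v then c u else 0) := by
  have g := h.tree.isGluing hvr hpv
  refine ⟨⟨g.left, fun u hu => ?_, fun u hu hur => ?_⟩, ⟨g.right, fun u hu => ?_,
    fun u hu huv => ?_⟩⟩
  · split_ifs with hd
    · rfl
    · exact h.support u fun hV => hu (Finset.mem_sdiff.2 ⟨hV, hd⟩)
  · have hlt := h.lt_sum u (Finset.mem_sdiff.1 hu).1 hur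
    rw [g.descendants_left hu hur] at hlt
    refine hlt.trans_eq (Finset.sum_congr rfl fun w hw => ?_)
    rw [if_neg (Finset.mem_sdiff.1 (g.left.descendants_subset hu hw)).2]
  · rw [if_neg hu]
  · have huV := h.tree.descendants_subset hv hu
    have hur : u ≠ r := fun e => h.tree.root_notMem_descendants hvr (e ▸ hu)
    have hlt := h.lt_sum u huV hur
    rw [g.descendants_right hu] at hlt
    refine hlt.trans_eq (Finset.sum_congr rfl fun w hw => ?_)
    rw [if_pos (g.right.descendants_subset hu hw)]

theorem IsPrimeOn.glue {A B : Finset α} {rA rB : α} {pA pB p : α → α} {cA cB : α → ℕ}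
    (hA : IsPrimeOn A rA pA cA) (hB : IsPrimeOn B rB pB cB)
    (g : IsGluing A B rA rB pA pB p) (hlt : B.card < ∑ u ∈ B, cB u) :
    IsPrimeOn (A ∪ B) rA p (cA + cB) := by
  refine ⟨g.isTreeOn, fun u hu => ?_, fun v hv hvr => ?_⟩
  · rw [Finset.mem_union, not_or] at hu
    simp [hA.support u hu.1, hB.support u hu.2]
  · rcases Finset.mem_union.1 hv with hv | hv
    · rw [g.descendants_left hv hvr]
      refine (hA.lt_sum v hv hvr).trans_le (Finset.sum_le_sum fun w _ => ?_)
      simp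
    · rw [g.descendants_right hv]
      refine lt_of_lt_of_le ?_
        (Finset.sum_le_sum (f := cB) (g := cA + cB) fun w _ => by simp)
      by_cases hvB : v = rB
      · rwa [hvB, hB.tree.descendants_root]
      · exact hB.lt_sum v hv hvB

/-- Cutting and gluing are inverse bijections. The pieces have `|V \ B| + a - 1` and `|B| + b - 1`
drivers, which add up to `|V| + q - 1` exactly when `a + b = q + 1`; the cut edge is crossed exactly
when `b ≥ 2`. -/
theorem card_markedPrimeTrees {V B : Finset α} (hBV : B ⊆ V) (q : ℕ) :
    (markedPrimeTrees V q B).card = ∑ ab ∈ Finset.HasAntidiagonal.antidiagonal (q + 1),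
      if 2 ≤ ab.2 then (primeTrees (V \ B) ab.1).card * (primeTrees B ab.2).card else 0 := by
  rw [← Finset.sum_filter]
  simp_rw [← Finset.card_product]
  rw [← Finset.card_sigma]
  refine Finset.card_bij'
    (fun y _ => ⟨(q + 1 - (∑ u ∈ B, y.1.2.2 u + 1 - B.card), ∑ u ∈ B, y.1.2.2 u + 1 - B.card),
      ((y.1.1, fun u => if u ∈ B then u else y.1.2.1 u, fun u => if u ∈ B then 0 else y.1.2.2 u),
        (y.2, fun u => if u ∈ B ∧ u ≠ y.2 then y.1.2.1 u else u,
          fun u => if u ∈ B then y.1.2.2 u else 0))⟩)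
    (fun z _ => ((z.2.1.1, fun u => if u = z.2.2.1 then z.2.1.1 else
      if u ∈ B then z.2.2.2.1 u else z.2.1.2.1 u, z.2.1.2.2 + z.2.2.2.2), z.2.2.1)) ?_ ?_ ?_ ?_
  · rintro ⟨⟨r, p, c⟩, v⟩ hy
    obtain ⟨⟨hx, hv⟩, ⟨hvr, hpv⟩, rfl⟩ := mem_markedPrimeTrees.1 hy
    obtain ⟨hp, hs⟩ := mem_primeTrees.1 hx
    dsimp only at hp hs hv hvr hpv hBV ⊢
    obtain ⟨h1, h2⟩ := hp.cut hv hvr hpv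
    have hlt := hp.lt_sum v hv hvr
    rw [← Finset.sum_sdiff hBV] at hs
    have hge := Finset.card_sdiff_add_card_eq_card hBV
    have e1 : ∑ u ∈ V \ descendants p v, (if u ∈ descendants p v then 0 else c u) =
        ∑ u ∈ V \ descendants p v, c u :=
      Finset.sum_congr rfl fun u hu => if_neg (Finset.mem_sdiff.1 hu).2
    have e2 : ∑ u ∈ descendants p v, (if u ∈ descendants p v then c u else 0) =
        ∑ u ∈ descendants p v, c u :=
      Finset.sum_congr rfl fun u hu => if_pos hu
    have hA := h1.card_le_sum_add_one
    rw [e1] at hA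
    simp only [Finset.mem_sigma, Finset.mem_filter, Finset.mem_product,
      Finset.HasAntidiagonal.mem_antidiagonal, mem_primeTrees]
    refine ⟨⟨by omega, by omega⟩, ⟨h1, ?_⟩, ⟨h2, ?_⟩⟩
    · rw [e1]; omega
    · rw [e2]; omega
  · rintro ⟨⟨a, b⟩, ⟨rA, pA, cA⟩, ⟨rB, pB, cB⟩⟩ hz
    simp only [Finset.mem_sigma, Finset.mem_filter, Finset.mem_product,
      Finset.HasAntidiagonal.mem_antidiagonal, mem_primeTrees] at hz
    obtain ⟨⟨hab, hb⟩, ⟨hA, hAs⟩, ⟨hB, hBs⟩⟩ := hz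
    have g := hA.tree.isGluing_ite hB.tree Finset.sdiff_disjoint
    have hP := hA.glue hB g (by omega)
    rw [Finset.sdiff_union_of_subset hBV] at hP
    refine mem_markedPrimeTrees.2 ⟨⟨mem_primeTrees.2 ⟨hP, ?_⟩, hBV hB.tree.root_mem⟩, ⟨?_, ?_⟩, ?_⟩
    · have e1 : ∑ u ∈ V \ B, (cA + cB) u = ∑ u ∈ V \ B, cA u :=
        Finset.sum_congr rfl fun u hu => by simp [hB.support u (Finset.mem_sdiff.1 hu).2]
      have e2 : ∑ u ∈ B, (cA + cB) u = ∑ u ∈ B, cB u :=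
        Finset.sum_congr rfl fun u hu => by
          simp [hA.support u fun hu' => (Finset.mem_sdiff.1 hu').2 hu]
      have hge := Finset.card_sdiff_add_card_eq_card hBV
      dsimp only at hab ⊢
      rw [← Finset.sum_sdiff hBV, e1, e2]
      omega
    · exact fun e => (Finset.mem_sdiff.1 hA.tree.root_mem).2 ((show rB = rA from e) ▸ hB.tree.root_mem)
    · exact if_pos rfl
    · exact (g.descendants_right hB.tree.root_mem).trans hB.tree.descendants_root
  · rintro ⟨⟨r, p, c⟩, v⟩ hy
    obtain ⟨⟨hx, hv⟩, ⟨hvr, hpv⟩, rfl⟩ := mem_markedPrimeTrees.1 hy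
    dsimp only at hv hvr hpv ⊢
    simp only [Prod.mk.injEq, true_and, and_true]
    constructor
    · funext u
      split_ifs with h1 h2 h3
      · rw [h1, hpv]
      · rfl
      · exact absurd ⟨h2, h1⟩ h3
      · rfl
    · funext u
      simp only [Pi.add_apply]
      split_ifs <;> simp
  · rintro ⟨⟨a, b⟩, ⟨rA, pA, cA⟩, ⟨rB, pB, cB⟩⟩ hz
    simp only [Finset.mem_sigma, Finset.mem_filter, Finset.mem_product,
      Finset.HasAntidiagonal.mem_antidiagonal, mem_primeTrees] at hz
    obtain ⟨⟨hab, hb⟩, ⟨hA, hAs⟩, ⟨hB, hBs⟩⟩ := hz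
    have cA0 : ∀ u ∈ B, cA u = 0 := fun u hu =>
      hA.support u fun hu' => (Finset.mem_sdiff.1 hu').2 hu
    have cB0 : ∀ u ∉ B, cB u = 0 := hB.support
    have e2 : ∑ u ∈ B, (cA + cB) u = ∑ u ∈ B, cB u :=
      Finset.sum_congr rfl fun u hu => by simp [cA0 u hu]
    dsimp only at hab hb hAs hBs hA hB ⊢
    rw [e2]
    simp only [Sigma.mk.injEq, Prod.mk.injEq, heq_eq_eq, true_and]
    refine ⟨⟨by omega, by omega⟩, ⟨?_, ?_⟩, ?_, ?_⟩
    · funext u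
      split_ifs with h1 h2
      · exact (hA.tree.map_off u fun hu' => (Finset.mem_sdiff.1 hu').2 h1).symm
      · exact absurd (h2 ▸ hB.tree.root_mem) h1
      · rfl
    · funext u
      split_ifs with h1
      · simp [cA0 u h1]
      · simp [cB0 u h1]
    · funext u
      by_cases h1 : u ∈ B
      · by_cases h2 : u = rB
        · simp [h2, hB.tree.map_root]
        · simp [h1, h2]
      · simp [h1, hB.tree.map_off u h1]
    · funext u
      split_ifs with h1
      · simp [cA0 u h1]
      · simp [cB0 u h1]

/-- Cutting the edges into the root expresses the number of prime trees on `V` through the numbers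
of prime trees on smaller sets. -/
theorem card_primeTrees_recursion (V : Finset α) (q : ℕ) :
    (V.card - 1) * (primeTrees V q).card = ∑ B ∈ V.powerset, B.card *
      ∑ ab ∈ Finset.HasAntidiagonal.antidiagonal (q + 1),
        if 2 ≤ ab.2 then (primeTrees (V \ B) ab.1).card * (primeTrees B ab.2).card else 0 := by
  rw [sum_card_mul_card_markedPrimeTrees]
  exact Finset.sum_congr rfl fun B hB => by
    rw [card_markedPrimeTrees (Finset.mem_powerset.1 hB)]

theorem primeTrees_empty (q : ℕ) : primeTrees (∅ : Finset α) q = ∅ := by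
  ext x
  simp only [mem_primeTrees, Finset.notMem_empty, iff_false, not_and]
  exact fun h => absurd h.tree.root_mem (Finset.notMem_empty _)

/-- Initial values, on which the recursion is silent because its factor `|V| - 1` vanishes. -/
theorem card_primeTrees_singleton (v : α) (q : ℕ) : (primeTrees {v} q).card = 1 := by
  rw [Finset.card_eq_one]
  refine ⟨(v, id, Pi.single v q), ?_⟩
  ext ⟨r, p, c⟩
  rw [mem_primeTrees, Finset.mem_singleton]
  constructor
  · rintro ⟨h, hs⟩
    dsimp only at h hs
    obtain rfl : r = v := Finset.mem_singleton.1 h.tree.root_mem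
    simp only [Prod.mk.injEq, true_and]
    constructor
    · funext u
      by_cases hu : u = r
      · rw [hu]; exact h.tree.map_root
      · exact h.tree.map_off u (by simpa using hu)
    · funext u
      by_cases hu : u = r
      · subst hu
        simp at hs ⊢
        omega
      · rw [Pi.single_eq_of_ne hu]
        exact h.support u (by simpa using hu)
  · intro h
    simp only [Prod.mk.injEq] at h
    obtain ⟨rfl, rfl, rfl⟩ := h
    refine ⟨⟨⟨by simp, rfl, fun u hu => hu, fun u _ => rfl, fun u hu => ⟨0, by simpa using hu⟩⟩,
      fun u hu => ?_, fun u hu hur => absurd (Finset.mem_singleton.1 hu) hur⟩, ?_⟩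
    · exact Pi.single_eq_of_ne (by simpa using hu) _
    · simp [add_comm]

end Trees

/-! ### Parking and subtree counts -/

namespace LabeledRootedTree

variable {n : ℕ} (T : LabeledRootedTree n)

theorem iterate_parent_root (k : ℕ) : T.parent^[k] T.root = T.root :=
  Function.iterate_fixed T.parent_root k

theorem iterate_parent_depth (v : Fin n) : T.parent^[T.depth v] v = T.root :=
  Nat.find_spec (T.exists_iterate_eq_root v)

theorem mem_pathToRoot_of_below {v w : Fin n} (h : T.Below v w) : w ∈ T.pathToRoot v := by
  obtain ⟨k, rfl⟩ := h
  rw [pathToRoot, List.mem_map]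
  rcases le_total k (T.depth v) with hk | hk
  · exact ⟨k, List.mem_range.2 (by omega), rfl⟩
  · refine ⟨T.depth v, List.mem_range.2 (by omega), ?_⟩
    obtain ⟨m, rfl⟩ := Nat.exists_eq_add_of_le hk
    rw [add_comm, Function.iterate_add_apply, iterate_parent_depth, iterate_parent_root]

theorem spot_eq_some {occ : Finset (Fin n)} {v x : Fin n} (h : T.spot occ v = some x) :
    x ∉ occ ∧ ∃ k, T.parent^[k] v = x ∧ ∀ j < k, T.parent^[j] v ∈ occ := by
  rw [spot, List.find?_eq_some_iff_getElem] at h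
  obtain ⟨hx, k, hk, hkx, hj⟩ := h
  refine ⟨by simpa using hx, k, by
    simpa only [pathToRoot, List.getElem_map, List.getElem_range] using hkx, fun j hjk => ?_⟩
  simpa only [pathToRoot, List.getElem_map, List.getElem_range, Bool.not_eq_true',
    decide_eq_false_iff_not, not_not] using hj j hjk

theorem isSome_spot {occ : Finset (Fin n)} {v w : Fin n} (h : T.Below v w) (hw : w ∉ occ) :
    (T.spot occ v).isSome := by
  rw [spot, List.find?_isSome]
  exact ⟨w, T.mem_pathToRoot_of_below h, by simpa using hw⟩

theorem subset_arrive (occ : Finset (Fin n)) (v : Fin n) : occ ⊆ T.arrive occ v := by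
  rw [arrive]
  split
  · exact Finset.subset_insert _ _
  · exact Finset.Subset.refl _

theorem card_arrive_le (occ : Finset (Fin n)) (v : Fin n) :
    (T.arrive occ v).card ≤ occ.card + 1 := by
  rw [arrive]
  split
  · exact Finset.card_insert_le _ _
  · omega

theorem card_foldl_arrive_le (l : List (Fin n)) (occ : Finset (Fin n)) :
    (l.foldl T.arrive occ).card ≤ occ.card + l.length := by
  induction l generalizing occ with
  | nil => simp
  | cons v l ih =>
    have := ih (T.arrive occ v)
    have := T.card_arrive_le occ v
    simp only [List.foldl_cons, List.length_cons]
    omega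

open Classical in
/-- As long as `w` is unoccupied, nobody has left the subtree below `w`. -/
theorem countP_below_le_of_notMem_occupied {w : Fin n} (l : List (Fin n))
    (hw : w ∉ T.occupied l) :
    l.countP (fun u => T.Below u w) ≤ ((T.occupied l).filter fun u => T.Below u w).card := by
  induction l using List.reverseRecOn with
  | nil => simp
  | append_singleton l u ih =>
    have e : T.occupied (l ++ [u]) = T.arrive (T.occupied l) u := by simp [occupied]
    rw [e] at hw ⊢
    have hsub := T.subset_arrive (T.occupied l) u
    have hw' : w ∉ T.occupied l := fun h => hw (hsub h)
    have ih := ih hw'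
    rw [List.countP_append, List.countP_singleton]
    split_ifs with hu
    · have hu : T.Below u w := by simpa using hu
      obtain ⟨x, hx⟩ := Option.isSome_iff_exists.1 (T.isSome_spot hu hw')
      obtain ⟨hxo, k, hk, hj⟩ := T.spot_eq_some hx
      obtain ⟨m, hm⟩ := hu
      have hkm : k ≤ m := by
        by_contra hlt
        exact hw' (hm ▸ hj m (not_le.1 hlt))
      have hxw : T.Below x w := by
        refine ⟨m - k, ?_⟩
        rw [← hk, ← Function.iterate_add_apply, Nat.sub_add_cancel hkm, hm]
      rw [arrive, hx]
      dsimp only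
      rw [Finset.filter_insert, if_pos hxw, Finset.card_insert_of_notMem]
      · omega
      · simp [hxo]
    · exact ih.trans (Finset.card_le_card (Finset.filter_subset_filter _ hsub))

theorem exists_card_lt_of_not_isParkingFunction {s : Fin n → Fin n}
    (h : ¬ T.IsParkingFunction s) :
    ∃ w, {i | s i ∈ T.below w}.ncard < (T.below w).ncard := by
  classical
  rw [IsParkingFunction, not_forall] at h
  obtain ⟨i, hi⟩ := h
  set l := List.ofFn s with hl
  have hlen : l.length = n := by simp [hl]
  have hil : (i : ℕ) < l.length := by simp [hlen]
  have hsplit : l = l.take i ++ (s i :: l.drop (i + 1)) := by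
    conv_lhs => rw [← List.take_append_drop i l]
    rw [List.drop_eq_getElem_cons hil]
    simp [hl]
  -- Each driver occupies at most one new spot and driver `i` occupies none.
  have hcard : (T.occupied l).card < n := by
    have h1 := T.card_foldl_arrive_le (l.take i) ∅
    have hnone : T.arrive (T.occupied (l.take i)) (s i) = T.occupied (l.take i) := by
      rw [arrive, Option.not_isSome_iff_eq_none.1 hi]
    have h2 := T.card_foldl_arrive_le (l.drop (i + 1)) (T.occupied (l.take i))
    have e : T.occupied l = (l.drop (i + 1)).foldl T.arrive (T.occupied (l.take i)) := by
      conv_lhs => rw [hsplit]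
      rw [occupied, List.foldl_append, List.foldl_cons]
      exact congrArg (fun o => List.foldl T.arrive o _) hnone
    rw [e]
    rw [List.length_drop] at h2
    rw [List.length_take] at h1
    rw [occupied] at h2 ⊢
    simp only [Finset.card_empty] at h1
    omega
  obtain ⟨w, hw⟩ : ∃ w, w ∉ T.occupied l := by
    by_contra! hall
    rw [Finset.eq_univ_of_forall hall, Finset.card_univ, Fintype.card_fin] at hcard
    exact lt_irrefl _ hcard
  refine ⟨w, ?_⟩
  have hle := T.countP_below_le_of_notMem_occupied l hw
  have e1 : {i | s i ∈ T.below w}.ncard = l.countP (fun u => T.Below u w) := by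
    have : {i | s i ∈ T.below w} = ((Finset.univ.filter fun i => T.Below (s i) w : Finset (Fin n)) :
        Set (Fin n)) := by
      ext; simp [below]
    rw [this, Set.ncard_coe_finset, hl, List.ofFn_eq_map, List.countP_map, Finset.card_def,
      Finset.filter_val, ← Multiset.countP_eq_card_filter, Fin.univ_def]
    simp only [Multiset.coe_countP]
    rfl
  have e2 : (T.below w).ncard = (Finset.univ.filter fun u => T.Below u w).card := by
    rw [← Set.ncard_coe_finset]
    congr 1
    ext; simp [below]
  rw [e1, e2]
  refine hle.trans_lt (Finset.card_lt_card ?_)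
  rw [Finset.ssubset_iff_of_subset (Finset.filter_subset_filter _ (Finset.subset_univ _))]
  exact ⟨w, by simpa using ⟨0, rfl⟩, by simp [hw]⟩

theorem isPrimeParkingFunction_iff {s : Fin n → Fin n} : T.IsPrimeParkingFunction s ↔
    ∀ v, v ≠ T.root → (T.below v).ncard < {i | s i ∈ T.below v}.ncard := by
  refine ⟨And.right, fun h => ⟨?_, h⟩⟩
  by_contra hp
  obtain ⟨w, hw⟩ := T.exists_card_lt_of_not_isParkingFunction hp
  by_cases hwr : w = T.root
  -- At the root both sides count to `n`, so the strict inequality fails there too.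
  · have : T.below w = Set.univ := Set.eq_univ_of_forall fun v =>
      hwr ▸ T.exists_iterate_eq_root v
    rw [this] at hw
    simp at hw
  · exact lt_asymm hw (h w hwr)

theorem coe_descendants_parent (v : Fin n) : (descendants T.parent v : Set (Fin n)) = T.below v := by
  ext u
  simp [mem_descendants, below, Below]

theorem isTreeOn_parent : IsTreeOn Finset.univ T.root T.parent :=
  ⟨Finset.mem_univ _, T.parent_root, fun _ _ => Finset.mem_univ _,
    fun u hu => absurd (Finset.mem_univ u) hu, fun u _ => T.exists_iterate_eq_root u⟩

end LabeledRootedTree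

/-! ### Weakly increasing sequences as multiplicity functions -/

/-- The number of drivers preferring each spot. -/
def preferenceCount {n : ℕ} (s : Fin n → Fin n) (v : Fin n) : ℕ :=
  (Finset.univ.filter fun i => s i = v).card

theorem sum_preferenceCount {n : ℕ} (s : Fin n → Fin n) (D : Finset (Fin n)) :
    ∑ v ∈ D, preferenceCount s v = {i | s i ∈ D}.ncard := by
  have : {i | s i ∈ D} = ((Finset.univ.filter fun i => s i ∈ D : Finset (Fin n)) : Set (Fin n)) := by
    ext; simp
  rw [this, Set.ncard_coe_finset, Finset.card_eq_sum_card_fiberwise (t := D) (f := s)]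
  · refine Finset.sum_congr rfl fun v hv => ?_
    rw [preferenceCount, Finset.filter_filter]
    congr 1
    ext i
    simp only [Finset.mem_filter, Finset.mem_univ, true_and]
    exact ⟨fun h => ⟨h ▸ hv, h⟩, And.right⟩
  · intro i hi
    simpa using hi

theorem sum_univ_preferenceCount {n : ℕ} (s : Fin n → Fin n) :
    ∑ v, preferenceCount s v = n := by
  rw [sum_preferenceCount]
  simp

theorem preferenceCount_eq_count {n : ℕ} (s : Fin n → Fin n) (v : Fin n) :
    preferenceCount s v = (List.ofFn s).count v := by
  rw [preferenceCount, List.ofFn_eq_map, List.count, List.countP_map, Finset.card_def,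
    Finset.filter_val, ← Multiset.countP_eq_card_filter, Fin.univ_def]
  simp only [Multiset.coe_countP]
  congr 1

theorem preferenceCount_injOn_monotone {n : ℕ} :
    Set.InjOn (preferenceCount (n := n)) {s | Monotone s} := by
  intro s hs t ht h
  have hp : (List.ofFn s).Perm (List.ofFn t) := List.perm_iff_count.2 fun v => by
    rw [← preferenceCount_eq_count, ← preferenceCount_eq_count, h]
  exact List.ofFn_injective (hp.eq_of_sortedLE hs.sortedLE_ofFn ht.sortedLE_ofFn)

theorem exists_monotone_preferenceCount_eq {n : ℕ} {c : Fin n → ℕ} (hc : ∑ v, c v = n) :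
    ∃ s : Fin n → Fin n, Monotone s ∧ preferenceCount s = c := by
  set m : Multiset (Fin n) := ∑ v, c v • {v} with hm
  have hcard : (m.sort (· ≤ ·)).length = n := by
    simp [hm, hc]
  refine ⟨fun i => (m.sort (· ≤ ·)).get (i.cast hcard.symm), ?_, ?_⟩
  · intro i j hij
    exact (m.pairwise_sort (· ≤ ·)).sortedLE.monotone_get hij
  · funext v
    have e : List.ofFn (fun i : Fin n => (m.sort (· ≤ ·)).get (i.cast hcard.symm)) =
        m.sort (· ≤ ·) := by
      refine List.ext_getElem (by simp [hcard]) fun i _ _ => ?_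
      simp
    rw [preferenceCount_eq_count, e, ← Multiset.coe_count, Multiset.sort_eq, hm,
      Multiset.count_sum']
    simp [Multiset.count_singleton]

/-! ### Euler derivations on power series in one and two variables -/

/-- The derivation `X * d/dX` of `ℚ⟦X⟧`. -/
noncomputable def eulerDerivation : Derivation ℚ (PowerSeries ℚ) (PowerSeries ℚ) :=
  (PowerSeries.X : PowerSeries ℚ) • PowerSeries.derivative ℚ

theorem coeff_eulerDerivation (f : PowerSeries ℚ) (n : ℕ) :
    PowerSeries.coeff n (eulerDerivation f) = n * PowerSeries.coeff n f := by
  cases n with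
  | zero => simp [eulerDerivation]
  | succ n =>
    simp [eulerDerivation, PowerSeries.coeff_succ_X_mul, PowerSeries.coeff_derivative, mul_comm]

theorem eulerDerivation_X : eulerDerivation PowerSeries.X = PowerSeries.X := by
  simp [eulerDerivation]

/-- The extension of `eulerDerivation` to power series over `ℚ⟦X⟧`, acting on coefficients. -/
noncomputable def eulerCoeff (F : PowerSeries (PowerSeries ℚ)) : PowerSeries (PowerSeries ℚ) :=
  PowerSeries.mk fun k => eulerDerivation (PowerSeries.coeff k F)

theorem coeff_eulerCoeff (F : PowerSeries (PowerSeries ℚ)) (k : ℕ) :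
    PowerSeries.coeff k (eulerCoeff F) = eulerDerivation (PowerSeries.coeff k F) :=
  PowerSeries.coeff_mk _ _

theorem eulerCoeff_add (F G : PowerSeries (PowerSeries ℚ)) :
    eulerCoeff (F + G) = eulerCoeff F + eulerCoeff G := by
  ext1 k; simp [coeff_eulerCoeff]

theorem eulerCoeff_sub (F G : PowerSeries (PowerSeries ℚ)) :
    eulerCoeff (F - G) = eulerCoeff F - eulerCoeff G := by
  ext1 k; simp [coeff_eulerCoeff]

theorem eulerCoeff_mul (F G : PowerSeries (PowerSeries ℚ)) :
    eulerCoeff (F * G) = eulerCoeff F * G + F * eulerCoeff G := by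
  ext1 k
  simp only [coeff_eulerCoeff, PowerSeries.coeff_mul, map_add, map_sum, ← Finset.sum_add_distrib,
    Derivation.leibniz, smul_eq_mul]
  exact Finset.sum_congr rfl fun _ _ => by ring

theorem eulerCoeff_C (f : PowerSeries ℚ) :
    eulerCoeff (PowerSeries.C f) = PowerSeries.C (eulerDerivation f) := by
  ext1 k
  simp only [coeff_eulerCoeff, PowerSeries.coeff_C]
  split_ifs <;> simp

theorem eulerCoeff_one : eulerCoeff 1 = 0 := by
  have h := eulerCoeff_C 1
  rwa [map_one, Derivation.map_one_eq_zero, map_zero] at h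

theorem eulerCoeff_X : eulerCoeff PowerSeries.X = 0 := by
  ext1 k
  simp only [coeff_eulerCoeff, PowerSeries.coeff_X]
  split_ifs <;> simp

theorem eulerCoeff_derivative (F : PowerSeries (PowerSeries ℚ)) :
    eulerCoeff (PowerSeries.derivative _ F) = PowerSeries.derivative _ (eulerCoeff F) := by
  ext1 k
  simp only [coeff_eulerCoeff, PowerSeries.coeff_derivative, Derivation.leibniz, smul_eq_mul]
  have : eulerDerivation ((k : PowerSeries ℚ) + 1) = 0 := by
    simp
  rw [this]; ring

/-! ### Schröder series -/

/-- The generating function of the large Schröder numbers, with rational coefficients. -/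
noncomputable def schroderSeries : PowerSeries ℚ := PowerSeries.mk fun n => (Nat.largeSchroder n : ℚ)

theorem schroderSeries_eq : schroderSeries =
    1 + PowerSeries.X * schroderSeries + PowerSeries.X * schroderSeries ^ 2 := by
  have h := congrArg (PowerSeries.map (Nat.castRingHom ℚ)) PowerSeries.largeSchroderSeries_eq_one_add_X_mul_largeSchroderSeries_add_X_mul_largeSchroderSeries_sq
  have e : PowerSeries.map (Nat.castRingHom ℚ) PowerSeries.largeSchroderSeries = schroderSeries := by
    ext n; simp [schroderSeries, PowerSeries.coeff_largeSchroderSeries]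
  simpa [e] using h

/-- The generating function of the little Schröder numbers `1, 1, 3, 11, …`. -/
noncomputable def littleSchroderSeries : PowerSeries ℚ := PowerSeries.C (1 / 2) * (1 + schroderSeries)

theorem schroderSeries_eq_two_mul : schroderSeries = 2 * littleSchroderSeries - 1 := by
  have : (2 : PowerSeries ℚ) * PowerSeries.C (1 / 2) = 1 := by
    rw [← map_ofNat PowerSeries.C 2, ← map_mul]; norm_num
  rw [littleSchroderSeries, ← mul_assoc, this]; ring

/-- Half of the quadratic equation for `schroderSeries`, rewritten in the little Schröder series.
Its Euler derivative enters the elimination in `parkingSeries_functional_equation`. -/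
theorem littleSchroderSeries_mul :
    littleSchroderSeries * (1 - PowerSeries.X * (2 * littleSchroderSeries - 1)) = 1 := by
  have h := schroderSeries_eq
  rw [schroderSeries_eq_two_mul] at h
  have h2 : (2 : PowerSeries ℚ) * (littleSchroderSeries *
      (1 - PowerSeries.X * (2 * littleSchroderSeries - 1)) - 1) = 0 := by
    linear_combination h
  exact sub_eq_zero.mp ((mul_eq_zero.mp h2).resolve_left fun h => by
    simpa only [map_ofNat, map_zero, OfNat.ofNat_ne_zero] using
      congrArg PowerSeries.constantCoeff h)

theorem constantCoeff_littleSchroderSeries :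
    PowerSeries.coeff 0 littleSchroderSeries = 1 := by
  simp [littleSchroderSeries, schroderSeries]
  norm_num

/-! ### The explicit solution and its functional equation -/

/-- The power series in `X` with `X ∂ₓ hₖ₊₁ + k hₖ₊₁ = (k - 1) hₖ + 2 s X ∂ₓ hₖ` and `h₀ = X`, where
`s` is the little Schröder series. -/
noncomputable def parkingColumn : ℕ → PowerSeries ℚ
  | 0 => PowerSeries.X
  | k + 1 => PowerSeries.mk fun N =>
      PowerSeries.coeff N (((k : PowerSeries ℚ) - 1) * parkingColumn k +
        2 * littleSchroderSeries * eulerDerivation (parkingColumn k)) / ((N : ℚ) + k)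

theorem coeff_natCast_sub_one_mul (k N : ℕ) (f : PowerSeries ℚ) :
    PowerSeries.coeff N (((k : PowerSeries ℚ) - 1) * f) = ((k : ℚ) - 1) * PowerSeries.coeff N f := by
  rw [show (k : PowerSeries ℚ) - 1 = PowerSeries.C ((k : ℚ) - 1) by simp, PowerSeries.coeff_C_mul]

theorem coeff_zero_mul_eulerDerivation (f g : PowerSeries ℚ) :
    PowerSeries.coeff 0 (f * eulerDerivation g) = 0 := by
  simp [PowerSeries.coeff_mul, coeff_eulerDerivation, -PowerSeries.coeff_zero_eq_constantCoeff]

theorem coeff_zero_parkingColumn (k : ℕ) : PowerSeries.coeff 0 (parkingColumn k) = 0 := by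
  induction k with
  | zero => simp [parkingColumn]
  | succ k ih =>
    rw [parkingColumn, PowerSeries.coeff_mk, map_add, coeff_natCast_sub_one_mul, ih,
      coeff_zero_mul_eulerDerivation]
    simp

theorem eulerDerivation_parkingColumn_succ (k : ℕ) :
    eulerDerivation (parkingColumn (k + 1)) + (k : PowerSeries ℚ) * parkingColumn (k + 1) =
      ((k : PowerSeries ℚ) - 1) * parkingColumn k +
        2 * littleSchroderSeries * eulerDerivation (parkingColumn k) := by
  ext N
  rw [map_add, coeff_eulerDerivation, show (k : PowerSeries ℚ) = PowerSeries.C (k : ℚ) by simp,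
    PowerSeries.coeff_C_mul, ← add_mul]
  rcases eq_or_ne ((N : ℚ) + k) 0 with h | h
  -- The denominator `N + k` in `parkingColumn` vanishes only for `N = k = 0`, and there the
  -- numerator vanishes as well.
  · have hN : N = 0 := by
      have : N + k = 0 := by exact_mod_cast h
      omega
    subst hN
    rw [← map_one PowerSeries.C, ← map_sub, map_add, coeff_zero_mul_eulerDerivation,
      PowerSeries.coeff_C_mul, coeff_zero_parkingColumn, coeff_zero_parkingColumn]
    simp
  · rw [parkingColumn, PowerSeries.coeff_mk, mul_div_cancel₀ _ h]
    simp

/-- Matches `card_primeTrees_singleton`. -/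
theorem coeff_one_parkingColumn (k : ℕ) : PowerSeries.coeff 1 (parkingColumn k) = 1 := by
  induction k with
  | zero => simp [parkingColumn]
  | succ k ih =>
    have h := congrArg (PowerSeries.coeff 1) (eulerDerivation_parkingColumn_succ k)
    rw [map_add, map_add, coeff_eulerDerivation, coeff_natCast_sub_one_mul, ih,
      show (k : PowerSeries ℚ) = PowerSeries.C (k : ℚ) by simp, PowerSeries.coeff_C_mul,
      mul_assoc, ← map_ofNat PowerSeries.C 2, PowerSeries.coeff_C_mul,
      PowerSeries.coeff_mul, Finset.Nat.antidiagonal_succ] at h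
    simp only [Finset.Nat.antidiagonal_zero, Finset.map_singleton, Finset.sum_cons,
      Finset.sum_singleton, coeff_eulerDerivation, Function.Embedding.prodMap] at h
    simp [ih] at h
    have c := constantCoeff_littleSchroderSeries
    simp at c
    rw [c] at h
    have h0 : (1 + (k : ℚ)) ≠ 0 := by positivity
    have : (1 + (k : ℚ)) * PowerSeries.coeff 1 (parkingColumn (k + 1)) = (1 + (k : ℚ)) * 1 := by
      linear_combination h
    exact mul_left_cancel₀ h0 this

/-- The case `k = 0` of the linear recursion, with `2 s - 1` equal to the Schröder series. This is
where the Schröder numbers enter the count. -/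
theorem eulerDerivation_parkingColumn_one :
    eulerDerivation (parkingColumn 1) = PowerSeries.X * schroderSeries := by
  have h := eulerDerivation_parkingColumn_succ 0
  simp only [parkingColumn, eulerDerivation_X] at h
  rw [schroderSeries_eq_two_mul]
  simp only [parkingColumn, eulerDerivation_X]
  push_cast at h ⊢
  linear_combination h

/-- The bivariate generating function with columns `parkingColumn`. -/
noncomputable def parkingSeries : PowerSeries (PowerSeries ℚ) := PowerSeries.mk parkingColumn

theorem coeff_parkingSeries (k : ℕ) : PowerSeries.coeff k parkingSeries = parkingColumn k :=
  PowerSeries.coeff_mk _ _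

/-- The linear recursion for the columns, multiplied by `t^(k+1)` and summed; the outer variable
plays the role of `t`. -/
theorem parkingSeries_pde :
    (2 * PowerSeries.C littleSchroderSeries * PowerSeries.X - 1) * eulerCoeff parkingSeries =
      PowerSeries.X * (1 - PowerSeries.X) * PowerSeries.derivative _ parkingSeries
        - (1 - PowerSeries.X) * parkingSeries := by
  have e1 : (2 * PowerSeries.C littleSchroderSeries * PowerSeries.X - 1) *
      eulerCoeff parkingSeries = PowerSeries.X * (PowerSeries.C (2 * littleSchroderSeries) *
        eulerCoeff parkingSeries) - eulerCoeff parkingSeries := by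
    rw [map_mul, map_ofNat]; ring
  have e2 : PowerSeries.X * (1 - PowerSeries.X) * PowerSeries.derivative _ parkingSeries
        - (1 - PowerSeries.X) * parkingSeries =
      PowerSeries.X * (PowerSeries.derivative _ parkingSeries
        - PowerSeries.X * PowerSeries.derivative _ parkingSeries + parkingSeries)
        - parkingSeries := by ring
  rw [e1, e2]
  ext1 k
  rcases k with _ | k
  · rw [map_sub, map_sub, PowerSeries.coeff_zero_X_mul, PowerSeries.coeff_zero_X_mul,
      coeff_eulerCoeff, coeff_parkingSeries, parkingColumn, eulerDerivation_X]
  · have h := eulerDerivation_parkingColumn_succ k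
    have e3 : PowerSeries.coeff k (PowerSeries.X * PowerSeries.derivative _ parkingSeries) =
        (k : PowerSeries ℚ) * parkingColumn k := by
      rcases k with _ | k
      · simp
      · rw [PowerSeries.coeff_succ_X_mul, PowerSeries.coeff_derivative, coeff_parkingSeries]
        push_cast; ring
    rw [map_sub, map_sub, PowerSeries.coeff_succ_X_mul, PowerSeries.coeff_succ_X_mul,
      PowerSeries.coeff_C_mul, map_add, map_sub, e3, PowerSeries.coeff_derivative]
    simp only [coeff_eulerCoeff, coeff_parkingSeries]
    linear_combination -h

/-- The defect `E` of this equation is shown to satisfy a homogeneous linear first-order equation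
along the same vector field as `parkingSeries_pde`. That equation forces all columns of `E` to
vanish once columns 0 and 1 and the constant terms do. -/
theorem parkingSeries_functional_equation :
    PowerSeries.X * (eulerCoeff parkingSeries - parkingSeries) =
      parkingSeries * (eulerCoeff parkingSeries - PowerSeries.C PowerSeries.X
        - PowerSeries.X * PowerSeries.C (PowerSeries.X * schroderSeries)) := by
  set h := parkingSeries with hh
  set a := eulerCoeff h with ha
  set E := a * (PowerSeries.X - h) - h * (PowerSeries.X - PowerSeries.C PowerSeries.X
        - PowerSeries.X * PowerSeries.C (PowerSeries.X * schroderSeries)) with hE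
  suffices E = 0 by linear_combination this
  set s := littleSchroderSeries with hs
  have pde := parkingSeries_pde
  rw [← hh, ← ha, ← hs] at pde
  have pde2 := congrArg eulerCoeff pde
  simp only [eulerCoeff_mul, eulerCoeff_sub, eulerCoeff_X, eulerCoeff_one, eulerCoeff_C,
    eulerCoeff_derivative] at pde2
  have two : eulerCoeff (2 : PowerSeries (PowerSeries ℚ)) = 0 := by
    rw [← one_add_one_eq_two, eulerCoeff_add, eulerCoeff_one, add_zero]
  rw [two, ← ha] at pde2
  -- A combination of the linear equation, its Euler derivative, and the Euler derivative of the
  -- quadratic equation for `s`.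
  have key : (2 * PowerSeries.C s * PowerSeries.X - 1) * eulerCoeff E -
      PowerSeries.X * (1 - PowerSeries.X) * PowerSeries.derivative _ E =
      (-2 * (1 - PowerSeries.X) - 2 * PowerSeries.X * PowerSeries.C (eulerDerivation s)) * E := by
    have r1 := littleSchroderSeries_mul
    rw [← hs] at r1
    have r2 := congrArg eulerDerivation r1
    have two' : eulerDerivation (2 : PowerSeries ℚ) = 0 := eulerDerivation.map_natCast 2
    simp only [Derivation.leibniz, smul_eq_mul, map_sub, Derivation.map_one_eq_zero, two',
      eulerDerivation_X] at r2
    have r2' := congrArg (PowerSeries.C (R := PowerSeries ℚ)) r2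
    rw [hE, schroderSeries_eq_two_mul, ← hs]
    simp only [eulerCoeff_mul, eulerCoeff_sub, eulerCoeff_X, eulerCoeff_C,
      Derivation.leibniz, smul_eq_mul, map_sub, PowerSeries.derivative_X,
      PowerSeries.derivative_C, Derivation.map_one_eq_zero, two', eulerDerivation_X, ← ha]
    simp only [map_mul, map_add, map_sub, map_one, map_zero,
      map_ofNat] at r2' ⊢
    linear_combination (PowerSeries.X - h) * pde2 - (a + PowerSeries.X - PowerSeries.C PowerSeries.X
      - PowerSeries.X * (PowerSeries.C PowerSeries.X * (2 * PowerSeries.C s - 1))) * pde +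
        (-2) * PowerSeries.X ^ 2 * h * r2'
  have constantCoeff_E : ∀ k, PowerSeries.coeff 0 (PowerSeries.coeff k E) = 0 := by
    have hk : PowerSeries.map (PowerSeries.constantCoeff (R := ℚ)) h = 0 := by
      ext1 k
      have := coeff_zero_parkingColumn k
      simpa [hh, coeff_parkingSeries] using this
    have ak : PowerSeries.map (PowerSeries.constantCoeff (R := ℚ)) a = 0 := by
      ext1 k
      have := coeff_eulerDerivation (parkingColumn k) 0
      simpa [ha, hh, coeff_parkingSeries, coeff_eulerCoeff] using this
    intro k
    have : PowerSeries.map (PowerSeries.constantCoeff (R := ℚ)) E = 0 := by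
      rw [hE, map_sub, map_mul, map_mul, hk, ak]; ring
    have := congrArg (PowerSeries.coeff k) this
    simpa using this
  have coeff_zero_E : PowerSeries.coeff 0 E = 0 := by
    have h0 : PowerSeries.constantCoeff h = PowerSeries.X := by
      simp [hh, parkingSeries, parkingColumn]
    have a0 : PowerSeries.constantCoeff a = PowerSeries.X := by
      simp [ha, hh, eulerCoeff, coeff_parkingSeries, parkingColumn, eulerDerivation_X]
    simp [hE, h0, a0]
  -- Needed separately: in column `k`, `key` multiplies the `N`-th coefficient of `E` by `N + k -
  -- 2`, which vanishes for `k = N = 1`. The choice of `∂h_1` makes this column zero.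
  have coeff_one_E : PowerSeries.coeff 1 E = 0 := by
    have h0 : PowerSeries.constantCoeff h = PowerSeries.X := by
      simp [hh, parkingSeries, parkingColumn]
    have a0 : PowerSeries.constantCoeff a = PowerSeries.X := by
      simp [ha, hh, eulerCoeff, coeff_parkingSeries, parkingColumn, eulerDerivation_X]
    have h1 : PowerSeries.coeff 1 h = parkingColumn 1 := coeff_parkingSeries 1
    have a1 : PowerSeries.coeff 1 a = PowerSeries.X * schroderSeries := by
      rw [ha, coeff_eulerCoeff, hh, coeff_parkingSeries, eulerDerivation_parkingColumn_one]
    rw [hE]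
    simp [PowerSeries.coeff_mul, Finset.Nat.antidiagonal_succ, h0, a0, h1, a1,
      PowerSeries.coeff_C, PowerSeries.coeff_X]
    ring
  ext1 k
  rw [map_zero]
  induction k with
  | zero => exact coeff_zero_E
  | succ k ih =>
    rcases k with _ | k
    · exact coeff_one_E
    obtain ⟨g, hg⟩ : ∃ g, g = 2 - 2 * eulerDerivation s := ⟨_, rfl⟩
    have key' : PowerSeries.X * (PowerSeries.C (2 * s) * eulerCoeff E) - eulerCoeff E -
        PowerSeries.X * (PowerSeries.derivative _ E - PowerSeries.X * PowerSeries.derivative _ E) =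
        PowerSeries.X * (PowerSeries.C g * E) - PowerSeries.C 2 * E := by
      rw [hg]
      simp only [map_mul, map_sub, map_ofNat] at key ⊢
      linear_combination key
    have hk := congrArg (PowerSeries.coeff (k + 1 + 1)) key'
    simp only [map_sub, PowerSeries.coeff_succ_X_mul, PowerSeries.coeff_C_mul,
      PowerSeries.coeff_derivative, coeff_eulerCoeff, ih, map_zero, mul_zero, zero_mul,
      zero_sub, sub_zero] at hk
    ext N
    have hN := congrArg (PowerSeries.coeff N) hk
    rcases N with _ | N
    · exact constantCoeff_E _
    have e : (((k + 1 : ℕ) : PowerSeries ℚ) + 1) = PowerSeries.C ((k : ℚ) + 2) := by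
      rw [map_add, map_natCast, map_ofNat]; push_cast; ring
    rw [e, mul_comm _ (PowerSeries.C _), ← map_ofNat PowerSeries.C 2, map_sub, map_neg, map_neg,
      coeff_eulerDerivation, PowerSeries.coeff_C_mul, PowerSeries.coeff_C_mul] at hN
    -- The factor `N + k - 2` with `N + 1` for `N` and `k + 2` for `k`.
    have hpos : ((N : ℚ) + 1 + k) ≠ 0 := by positivity
    rw [map_zero]
    refine (mul_eq_zero.mp ?_).resolve_left hpos
    push_cast at hN
    linear_combination -hN

/-- The coefficient of `t^(q+1) x^N` in the functional equation. The two subtracted terms are `∂h_0`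
and `t ∂h_1`, so exactly the terms with `ab.2 ≥ 2` survive, as in `card_primeTrees_recursion`. -/
theorem coeff_parkingColumn_convolution (N q : ℕ) :
    ((N : ℚ) - 1) * PowerSeries.coeff N (parkingColumn q) =
      ∑ ij ∈ Finset.HasAntidiagonal.antidiagonal N, (ij.2 : ℚ) * ∑ ab ∈ Finset.HasAntidiagonal.antidiagonal (q + 1),
        if 2 ≤ ab.2 then PowerSeries.coeff ij.1 (parkingColumn ab.1) *
          PowerSeries.coeff ij.2 (parkingColumn ab.2) else 0 := by
  have h := congrArg (fun F => PowerSeries.coeff N (PowerSeries.coeff (q + 1) F))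
    parkingSeries_functional_equation
  rw [PowerSeries.coeff_succ_X_mul, map_sub, map_sub, coeff_eulerCoeff, coeff_parkingSeries,
    coeff_eulerDerivation, PowerSeries.coeff_mul, map_sum] at h
  rw [sub_mul, one_mul, h]
  simp only [Finset.mul_sum]
  rw [Finset.sum_comm]
  refine Finset.sum_congr rfl fun ab _ => ?_
  have e : PowerSeries.coeff ab.2 (eulerCoeff parkingSeries - PowerSeries.C PowerSeries.X
        - PowerSeries.X * PowerSeries.C (PowerSeries.X * schroderSeries)) =
      if 2 ≤ ab.2 then eulerDerivation (parkingColumn ab.2) else 0 := by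
    rw [map_sub, map_sub, coeff_eulerCoeff, coeff_parkingSeries]
    rcases ab.2 with _ | _ | m
    · simp [parkingColumn, eulerDerivation_X]
    · simp [PowerSeries.coeff_succ_X_mul, PowerSeries.coeff_C, eulerDerivation_parkingColumn_one]
    · simp [PowerSeries.coeff_succ_X_mul]
  rw [e, PowerSeries.coeff_mul]
  refine Finset.sum_congr rfl fun ij _ => ?_
  rw [coeff_parkingSeries]
  split_ifs
  · rw [coeff_eulerDerivation]; ring
  · simp

theorem natCast_mul_coeff_parkingColumn_one (n : ℕ) :
    ((n : ℚ) + 1) * PowerSeries.coeff (n + 1) (parkingColumn 1) = Nat.largeSchroder n := by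
  have h := congrArg (PowerSeries.coeff (n + 1)) eulerDerivation_parkingColumn_one
  rw [coeff_eulerDerivation, PowerSeries.coeff_succ_X_mul, schroderSeries,
    PowerSeries.coeff_mk] at h
  exact_mod_cast h

/-! ### The count of prime trees and the theorem -/

/-- Both sides satisfy the same recursion on `|V|`, which determines them for `|V| ≥ 2` since `|V| -
1 ≠ 0`. -/
theorem card_primeTrees {α : Type*} [Fintype α] [DecidableEq α] (V : Finset α) (q : ℕ) :
    ((primeTrees V q).card : ℚ) =
      V.card.factorial * PowerSeries.coeff V.card (parkingColumn q) := by
  induction hN : V.card using Nat.strong_induction_on generalizing V q with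
  | _ N ih =>
  subst hN
  rcases Nat.lt_or_ge V.card 2 with hlt | hge
  · interval_cases hc : V.card
    · rw [Finset.card_eq_zero.1 hc, primeTrees_empty, coeff_zero_parkingColumn]
      simp
    · obtain ⟨v, rfl⟩ := Finset.card_eq_one.1 hc
      rw [card_primeTrees_singleton, coeff_one_parkingColumn]
      simp
  have hrec := congrArg (Nat.cast (R := ℚ)) (card_primeTrees_recursion V q)
  set f : ℕ → ℚ := fun j => ((V.card - j).factorial * j.factorial : ℚ) * (j * ∑ ab ∈
    Finset.HasAntidiagonal.antidiagonal (q + 1), if 2 ≤ ab.2 then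
      PowerSeries.coeff (V.card - j) (parkingColumn ab.1) *
        PowerSeries.coeff j (parkingColumn ab.2) else 0) with hf
  have hterm : ∀ B ∈ V.powerset, (B.card : ℚ) * ∑ ab ∈
      Finset.HasAntidiagonal.antidiagonal (q + 1), (if 2 ≤ ab.2 then
        ((primeTrees (V \ B) ab.1).card : ℚ) * (primeTrees B ab.2).card else 0) = f B.card := by
    intro B hB
    have hBV := Finset.mem_powerset.1 hB
    simp only [hf, Finset.mul_sum]
    refine Finset.sum_congr rfl fun ab _ => ?_
    split_ifs with hab
    swap
    · simp
    rcases B.eq_empty_or_nonempty with rfl | hne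
    · simp
    have hsd := Finset.card_sdiff_of_subset hBV
    have hpos := hne.card_pos
    -- For `B = V` the root piece is empty and both sides vanish; otherwise both pieces are smaller
    -- than `V`.
    rcases hBV.eq_or_ssubset with rfl | hss
    · simp [primeTrees_empty, coeff_zero_parkingColumn,
        -PowerSeries.coeff_zero_eq_constantCoeff]
    · rw [ih (V \ B).card (by omega) (V \ B) ab.1 rfl,
        ih B.card (Finset.card_lt_card hss) B ab.2 rfl, hsd]
      ring
  push_cast at hrec
  rw [Finset.sum_congr rfl hterm, Finset.sum_powerset_apply_card] at hrec
  have hconv := coeff_parkingColumn_convolution V.card q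
  rw [← Finset.Nat.sum_antidiagonal_swap, Finset.Nat.sum_antidiagonal_eq_sum_range_succ_mk] at hconv
  -- The binomial coefficient counting the sets `B` of size `m` cancels the factorials of the two
  -- pieces against `|V|!`.
  have hsum : ∑ m ∈ Finset.range (V.card + 1), V.card.choose m • f m =
      V.card.factorial * (((V.card : ℚ) - 1) * PowerSeries.coeff V.card (parkingColumn q)) := by
    rw [hconv, Finset.mul_sum]
    refine Finset.sum_congr rfl fun m hm => ?_
    have hmN := Nat.lt_succ_iff.1 (Finset.mem_range.1 hm)
    rw [← Nat.choose_mul_factorial_mul_factorial hmN, nsmul_eq_mul]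
    simp only [hf, Prod.swap_prod_mk]
    push_cast
    ring
  rw [hsum, Nat.cast_sub (by omega : 1 ≤ V.card), Nat.cast_one] at hrec
  have hne : (V.card : ℚ) - 1 ≠ 0 := by
    have : (2 : ℚ) ≤ V.card := by exact_mod_cast hge
    linarith
  refine mul_left_cancel₀ hne ?_
  linear_combination hrec

theorem theorem1p4 (n : ℕ) (hn : 1 ≤ n) :
    {p : LabeledRootedTree n × (Fin n → Fin n) | p.1.IsPrimeParkingDistribution p.2}.ncard =
      (n - 1).factorial * Nat.largeSchroder (n - 1) := by
  -- As many drivers as vertices means `q = 1`.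
  have hcard : {p : LabeledRootedTree n × (Fin n → Fin n) |
      p.1.IsPrimeParkingDistribution p.2}.ncard =
      (primeTrees (Finset.univ : Finset (Fin n)) 1).card := by
    rw [← Set.ncard_coe_finset]
    refine Set.ncard_congr (fun x _ => (x.1.root, x.1.parent, preferenceCount x.2)) ?_ ?_ ?_
    · rintro ⟨T, s⟩ ⟨hp, hs⟩
      rw [T.isPrimeParkingFunction_iff] at hp
      rw [Finset.mem_coe, mem_primeTrees]
      refine ⟨⟨T.isTreeOn_parent, fun u hu => absurd (Finset.mem_univ u) hu, fun v _ hv => ?_⟩, ?_⟩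
      · have h := hp v hv
        rw [← T.coe_descendants_parent, Set.ncard_coe_finset] at h
        rwa [sum_preferenceCount]
      · simp [sum_univ_preferenceCount]
    · rintro ⟨T, s⟩ ⟨T', s'⟩ ⟨-, hs⟩ ⟨-, hs'⟩ h
      simp only [Prod.mk.injEq] at h
      exact Prod.ext (LabeledRootedTree.ext h.1 h.2.1)
        (preferenceCount_injOn_monotone hs hs' h.2.2)
    · rintro ⟨r, p, c⟩ hx
      rw [Finset.mem_coe, mem_primeTrees] at hx
      obtain ⟨h, hsum⟩ := hx
      obtain ⟨s, hs, hc⟩ := exists_monotone_preferenceCount_eq (c := c) (by simpa using hsum)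
      refine ⟨(⟨r, p, h.tree.map_root, fun v => h.tree.reach v (Finset.mem_univ v)⟩, s),
        ⟨(LabeledRootedTree.isPrimeParkingFunction_iff _).2 fun v hv => ?_, hs⟩, ?_⟩
      · have hlt := h.lt_sum v (Finset.mem_univ v) hv
        dsimp only at hlt
        rw [← hc, sum_preferenceCount] at hlt
        rwa [← LabeledRootedTree.coe_descendants_parent, Set.ncard_coe_finset]
      · simp only [hc]
  rw [hcard]
  obtain ⟨m, rfl⟩ : ∃ m, n = m + 1 := ⟨n - 1, by omega⟩
  have h1 := card_primeTrees (Finset.univ : Finset (Fin (m + 1))) 1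
  have h2 := natCast_mul_coeff_parkingColumn_one m
  rw [Finset.card_univ, Fintype.card_fin, Nat.factorial_succ] at h1
  rw [Nat.add_sub_cancel]
  have h3 : ((primeTrees (Finset.univ : Finset (Fin (m + 1))) 1).card : ℚ) =
      ((m.factorial * Nat.largeSchroder m : ℕ) : ℚ) := by
    rw [h1]
    push_cast
    rw [← h2]
    ring
  exact_mod_cast h3
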